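/- Let $G$ be a finite group. Its generating graph $\Gamma(G)$ has the elements of $G$ as vertices, and $x,y$ are joined if and only if $\langle x,y\rangle=G$ (so an element that generates $G$ by itself carries a loop). Call two elements equivalent if they have the same set of neighbours in $\Gamma(G)$; the reduced generating graph $\overline{\Gamma}(G)$ has the equivalence classes as vertices, two classes being joined if their members are joined in $\Gamma(G)$. The automorphism group $\mathrm{Aut}(G)$ permutes the equivalence classes, and $\mathrm{Aut}^*(G)\le\mathrm{Aut}(\overline{\Gamma}(G))$ denotes the group that it induces on $\overline{\Gamma}(G)$; we write $\mathrm{Aut}^*(G)=\mathrm{Aut}(G)$ if the natural surjection $\mathrm{Aut}(G)\to\mathrm{Aut}^*(G)$ is an isomorphism. The spread of $G$ is the largest $k$ (possibly $\infty$) such that for any at most $k$ nonidentity elements of $G$ there is an $x\in G$ that generates $G$ together with each one of them. Theorem. Let $G$ be a finite group of nonzero spread that is not the trivial group, not cyclic of order $2$, and not isomorphic to $C_2\times C_2$. Then $\mathrm{Aut}^*(G)=\mathrm{Aut}(G)$ if and only if $G$ is nonabelian. -/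

import Mathlib

/-- An undirected graph on the vertex set `V` in which loops are allowed. -/
structure LoopGraph (V : Type*) where
  Adj : V → V → Prop
  symm : ∀ x y, Adj x y → Adj y x

namespace LoopGraph

/-- The automorphism group of a graph: the permutations of the vertices that preserve
adjacency and non-adjacency, under composition. -/
abbrev Aut {V : Type*} (X : LoopGraph V) : Type _ := X.Adj ≃r X.Adj

/-- Two vertices are equivalent if they have the same set of neighbours. -/
def sameNbrs {V : Type*} (X : LoopGraph V) : Setoid V where
  r x y := ∀ z, X.Adj x z ↔ X.Adj y z
  iseqv :=
    { refl := fun _ _ => Iff.rfl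
      symm := fun h z => (h z).symm
      trans := fun h k z => (h z).trans (k z) }

/-- The reduced graph: its vertices are the classes of vertices with the same neighbours, two
classes being joined if their members are joined. -/
def reduced {V : Type*} (X : LoopGraph V) : LoopGraph (Quotient X.sameNbrs) where
  Adj := Quotient.lift₂ X.Adj (by
    intro a b c d hac hbd
    have hac' : ∀ z, X.Adj a z ↔ X.Adj c z := hac
    have hbd' : ∀ z, X.Adj b z ↔ X.Adj d z := hbd
    refine propext ((hac' b).trans ?_)
    exact ⟨fun h => X.symm _ _ ((hbd' c).1 (X.symm _ _ h)),
      fun h => X.symm _ _ ((hbd' c).2 (X.symm _ _ h))⟩)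
  symm := by
    intro x y
    induction x using Quotient.inductionOn
    induction y using Quotient.inductionOn
    exact X.symm _ _

theorem sameNbrs_iff {V : Type*} (X : LoopGraph V) (f : X.Aut) (x y : V) :
    X.sameNbrs.r x y ↔ X.sameNbrs.r (f x) (f y) := by
  constructor
  · intro h z
    have hz := h (f.symm z)
    rw [← f.map_rel_iff, ← f.map_rel_iff (a := y)] at hz
    simpa using hz
  · intro h z
    have hz := h (f z)
    rwa [f.map_rel_iff, f.map_rel_iff] at hz

/-- The automorphism of the reduced graph induced by an automorphism `f` of the graph: it sends
the class of `x` to the class of `f x`. -/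
def reducedAut {V : Type*} (X : LoopGraph V) : X.Aut →* X.reduced.Aut where
  toFun f :=
    { toEquiv := Quotient.congr f.toEquiv (fun x y => X.sameNbrs_iff f x y)
      map_rel_iff' := by
        intro x y
        induction x using Quotient.inductionOn
        induction y using Quotient.inductionOn
        exact f.map_rel_iff }
  map_one' := by
    ext x
    induction x using Quotient.inductionOn
    rfl
  map_mul' f g := by
    ext x
    induction x using Quotient.inductionOn
    rfl

end LoopGraph

/-- The generating graph of a group: the vertices are the group elements, and `x`, `y` are joined
if they generate the group.  An element that generates the group alone carries a loop. -/
def generatingGraph (G : Type*) [Group G] : LoopGraph G where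
  Adj x y := Subgroup.closure {x, y} = ⊤
  symm x y h := by rwa [Set.pair_comm]

/-- The reduced generating graph. -/
abbrev reducedGeneratingGraph (G : Type*) [Group G] :
    LoopGraph (Quotient (generatingGraph G).sameNbrs) :=
  (generatingGraph G).reduced

theorem generatingGraph_adj_iff {G : Type*} [Group G] (a : MulAut G) (x y : G) :
    (generatingGraph G).Adj (a x) (a y) ↔ (generatingGraph G).Adj x y := by
  have h : Subgroup.closure {a x, a y} = (Subgroup.closure {x, y}).map a.toMonoidHom := by
    rw [MonoidHom.map_closure, Set.image_pair]
    rfl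
  change Subgroup.closure {a x, a y} = ⊤ ↔ Subgroup.closure {x, y} = ⊤
  rw [h]
  constructor
  · intro h'
    apply Subgroup.map_injective (f := a.toMonoidHom) a.injective
    rw [h', Subgroup.map_top_of_surjective _ a.surjective]
  · intro h'
    rw [h', Subgroup.map_top_of_surjective _ a.surjective]

/-- The action of the automorphism group of `G` on the generating graph. -/
def autGeneratingGraph (G : Type*) [Group G] : MulAut G →* (generatingGraph G).Aut where
  toFun a := { toEquiv := a.toEquiv, map_rel_iff' := generatingGraph_adj_iff a _ _ }
  map_one' := rfl
  map_mul' _ _ := rfl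

/-- The action of the automorphism group of `G` on the reduced generating graph: an automorphism
`a` of `G` sends the class of `x` to the class of `a x`. -/
def autReducedGeneratingGraph (G : Type*) [Group G] :
    MulAut G →* (reducedGeneratingGraph G).Aut :=
  (generatingGraph G).reducedAut.comp (autGeneratingGraph G)

/-- `Aut*(G)`: the group of permutations that the automorphism group of `G` induces on the
reduced generating graph. -/
def AutStar (G : Type*) [Group G] : Subgroup (reducedGeneratingGraph G).Aut :=
  (autReducedGeneratingGraph G).range

/-- The natural surjection from the automorphism group of `G` to `Aut*(G)`. -/
def toAutStar (G : Type*) [Group G] : MulAut G →* AutStar G :=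
  (autReducedGeneratingGraph G).rangeRestrict

/-- The spread of `G`: the largest `k` such that for any (at most) `k` nonidentity elements of `G`
some element of `G` generates `G` together with each one of them; it is `⊤` if there is no largest
`k`, as for cyclic groups.  Repetitions among the `k` elements are allowed, so that the condition
is not void for `k` greater than the number of nonidentity elements. -/
noncomputable def spread (G : Type*) [Group G] : ℕ∞ :=
  ⨆ (k : ℕ) (_ : ∀ S : Finset G, S.card ≤ k → (∀ s ∈ S, s ≠ 1) →
    ∃ x : G, ∀ s ∈ S, Subgroup.closure {x, s} = ⊤), (k : ℕ∞)

/-! Nonzero spread gives every nonidentity element a mate, that is, a partner with which it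
generates `G`. In an abelian group inversion acts trivially on the reduced graph, so faithfulness
forces exponent 2; two generators then leave only order at most 4. For nonabelian `G`, let `N`
consist of the elements whose conjugation lies in the kernel of `toAutStar G`. If `N` is nontrivial,
a minimal normal subgroup `M` of `G` inside `N` is abelian, by a Frattini argument
(`isMulCommutative_of_minimal`), and this makes `G` abelian (`mul_comm_of_ne_bot`). So `N` is
trivial, and a commutator computation (`inv_mul_apply_mem_comap_conj`) makes the whole kernel
trivial. -/

open Subgroup in
theorem exists_closure_pair_eq_top_of_spread_ne_zero {G : Type*} [Group G] (h : spread G ≠ 0)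
    {s : G} (hs : s ≠ 1) : ∃ x : G, closure {s, x} = ⊤ := by
  by_contra hno
  apply h
  rw [spread]
  simp only [ENat.iSup_eq_zero, Nat.cast_eq_zero]
  intro k hk
  by_contra hk0
  obtain ⟨x, hx⟩ := hk {s} (by simp; omega) (by simpa using hs)
  exact hno ⟨x, by rw [Set.pair_comm]; exact hx s (by simp)⟩

theorem mem_ker_toAutStar_iff {G : Type*} [Group G] (a : MulAut G) :
    a ∈ (toAutStar G).ker ↔
      ∀ x y : G, Subgroup.closure {a x, y} = ⊤ ↔ Subgroup.closure {x, y} = ⊤ := by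
  have hker : (toAutStar G).ker = (autReducedGeneratingGraph G).ker :=
    MonoidHom.ker_rangeRestrict _
  rw [hker, MonoidHom.mem_ker]
  constructor
  · intro h x
    exact Quotient.exact (s := (generatingGraph G).sameNbrs) (DFunLike.congr_fun h ⟦x⟧)
  · intro h
    ext x
    induction x using Quotient.inductionOn with
    | _ x => exact Quotient.sound (s := (generatingGraph G).sameNbrs) (h x)

namespace Subgroup

variable {G : Type*} [Group G]

theorem closure_conj_pair_eq_top_iff (g x y : G) :
    closure {g * x * g⁻¹, g * y * g⁻¹} = ⊤ ↔ closure {x, y} = ⊤ :=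
  generatingGraph_adj_iff (MulAut.conj g) x y

theorem closure_pair_eq_top_of_mem {x y x' y' : G} (h : closure {x, y} = ⊤)
    (hx : x ∈ closure {x', y'}) (hy : y ∈ closure {x', y'}) : closure {x', y'} = ⊤ := by
  rw [eq_top_iff, ← h, closure_le]
  rintro z (rfl | rfl)
  exacts [hx, hy]

theorem left_mem_closure_pair (x y : G) : x ∈ closure {x, y} := subset_closure (by simp)

theorem right_mem_closure_pair (x y : G) : y ∈ closure {x, y} := subset_closure (by simp)

theorem closure_pair_mul_right {x y : G} (h : closure {x, y} = ⊤) :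
    closure {x, x * y} = ⊤ := by
  refine closure_pair_eq_top_of_mem h (left_mem_closure_pair _ _) ?_
  simpa using mul_mem (inv_mem (left_mem_closure_pair x (x * y)))
    (right_mem_closure_pair x (x * y))

theorem closure_pair_inv_mul_right {x y : G} (h : closure {x, y} = ⊤) :
    closure {x, x⁻¹ * y} = ⊤ := by
  refine closure_pair_eq_top_of_mem h (left_mem_closure_pair _ _) ?_
  simpa using mul_mem (left_mem_closure_pair x (x⁻¹ * y)) (right_mem_closure_pair x (x⁻¹ * y))

/-- `N` preserves generating pairs if conjugating one member of a generating pair by an element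
of `N` gives a generating pair. -/
def PreservesGeneratingPairs (N : Subgroup G) : Prop :=
  ∀ n ∈ N, ∀ x y : G, closure {n * x * n⁻¹, y} = ⊤ ↔ closure {x, y} = ⊤

variable {N : Subgroup G}

/-- Since `G = N⟨y⟩`, write `g = n * y ^ i`: conjugation by `y ^ i` fixes `y`, and `n` is covered by
the hypothesis on `N`. -/
theorem PreservesGeneratingPairs.conj (hN : N.PreservesGeneratingPairs) [N.Normal] {x y : G}
    (hx : x ∈ N) (h : closure {x, y} = ⊤) (g : G) : closure {g * x * g⁻¹, y} = ⊤ := by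
  have htop : N ⊔ zpowers y = ⊤ := by
    rw [eq_top_iff, ← h, closure_le]
    rintro z (rfl | rfl)
    exacts [mem_sup_left hx, mem_sup_right (mem_zpowers _)]
  obtain ⟨n, hn, _, ⟨i, rfl⟩, rfl⟩ := mem_sup_of_normal_left.1 (htop ▸ mem_top g)
  have h1 := (closure_conj_pair_eq_top_iff (y ^ i) x y).2 h
  rw [show y ^ i * y * (y ^ i)⁻¹ = y by group] at h1
  have h2 := (hN n hn _ _).2 h1
  simpa [mul_assoc] using h2

/-- `w` is a product of conjugates of `x` and their inverses. Each factor is absorbed by replacing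
`x` with that conjugate, multiplying, and conjugating back. -/
theorem PreservesGeneratingPairs.mul_right (hN : N.PreservesGeneratingPairs) [N.Normal] {x y : G}
    (hx : x ∈ N) (h : closure {x, y} = ⊤) {w : G} (hw : w ∈ normalClosure {x}) :
    closure {x, w * y} = ⊤ := by
  have back : ∀ (g z : G), closure {g * x * g⁻¹, z} = ⊤ → closure {x, z} = ⊤ := by
    intro g z hz
    simpa [mul_assoc] using hN.conj (Normal.conj_mem ‹_› x hx g) hz g⁻¹
  rw [normalClosure] at hw
  induction hw using closure_induction_left with
  | one => simpa using h
  | mul_left z hz w _ ih =>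
    obtain ⟨_, rfl, hc⟩ := Group.mem_conjugatesOfSet_iff.1 hz
    obtain ⟨g, rfl⟩ := isConj_iff.1 hc
    rw [mul_assoc _ w]
    exact back g _ (closure_pair_mul_right (hN.conj hx ih g))
  | inv_mul_cancel z hz w _ ih =>
    obtain ⟨_, rfl, hc⟩ := Group.mem_conjugatesOfSet_iff.1 hz
    obtain ⟨g, rfl⟩ := isConj_iff.1 hc
    rw [mul_assoc _ w]
    exact back g _ (closure_pair_inv_mul_right (hN.conj hx ih g))

theorem PreservesGeneratingPairs.isMulCommutative_of_minimal [Finite G]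
    (hmate : ∀ s : G, s ≠ 1 → ∃ x : G, closure {s, x} = ⊤) {M : Subgroup G}
    (hM : M.PreservesGeneratingPairs) [M.Normal] (hbot : M ≠ ⊥)
    (hmin : ∀ L : Subgroup G, L.Normal → L ≠ ⊥ → L ≤ M → L = M) :
    ∀ x ∈ M, ∀ y ∈ M, x * y = y * x := by
  have hcard : Nat.card M ≠ 1 := fun h => hbot (card_eq_one.1 h)
  obtain ⟨p, hp, hdvd⟩ := Nat.exists_prime_and_dvd hcard
  have : Fact p.Prime := ⟨hp⟩
  obtain ⟨P⟩ : Nonempty (Sylow p M) := inferInstance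
  have hPne : ((P : Subgroup M).map M.subtype) ≠ ⊥ := by
    rw [Ne, map_eq_bot_iff_of_injective _ M.subtype_injective]
    exact P.ne_bot_of_dvd_card hdvd
  obtain ⟨x, hxP, hx1⟩ := (bot_or_exists_ne_one _).resolve_left hPne
  have hxM : x ∈ M := map_subtype_le _ hxP
  have hclos : normalClosure {x} = M := by
    refine hmin _ inferInstance (fun h => hx1 ?_) (normalClosure_le_normal (by simpa using hxM))
    rw [← mem_bot, ← h]
    exact subset_normalClosure rfl
  obtain ⟨y, hy⟩ := hmate x hx1
  -- Frattini: `y = m * k` with `k` normalizing the Sylow subgroup `P`. As `x` has normal closure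
  -- `M`, the factor `m` can be dropped, so `x` and `k` generate `G` and both normalize `P`.
  obtain ⟨m, hm, k, hk, rfl⟩ := mem_sup_of_normal_left.1
    ((sup_comm _ _).trans P.normalizer_sup_eq_top ▸ mem_top y)
  have hgen := hM.mul_right hxM hy (w := m⁻¹) (hclos.symm ▸ inv_mem hm)
  rw [inv_mul_cancel_left] at hgen
  have hnorm : ((P : Subgroup M).map M.subtype).Normal := by
    rw [← normalizer_eq_top_iff, eq_top_iff, ← hgen, closure_le]
    rintro z (rfl | rfl)
    exacts [le_normalizer hxP, hk]
  have hPtop : (P : Subgroup M) = ⊤ := by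
    apply map_injective M.subtype_injective
    rw [hmin _ hnorm hPne (map_subtype_le _), ← MonoidHom.range_eq_map, range_subtype]
  have hpg : IsPGroup p M := by
    have := P.isPGroup'
    rw [hPtop] at this
    exact this.of_equiv topEquiv
  have : Nontrivial M := (nontrivial_iff_ne_bot M).2 hbot
  have := hpg.center_nontrivial
  have hcen : (center M).map M.subtype = M := by
    refine hmin _ inferInstance ?_ (map_subtype_le _)
    rw [Ne, map_eq_bot_iff_of_injective _ M.subtype_injective]
    exact (nontrivial_iff_ne_bot _).1 inferInstance
  intro a ha b hb
  rw [← hcen] at ha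
  obtain ⟨a, hac, rfl⟩ := ha
  exact congrArg Subtype.val (mem_center_iff.1 hac ⟨b, hb⟩).symm

theorem PreservesGeneratingPairs.mul_comm_of_ne_bot [Finite G]
    (hmate : ∀ s : G, s ≠ 1 → ∃ x : G, closure {s, x} = ⊤) (hN : N.PreservesGeneratingPairs)
    [N.Normal] (hbot : N ≠ ⊥) (a b : G) : a * b = b * a := by
  obtain ⟨M, hMN, ⟨hMnormal, hMbot⟩, hMmin⟩ := Set.Finite.exists_le_minimal
    (Set.toFinite {L : Subgroup G | L.Normal ∧ L ≠ ⊥}) (a := N) ⟨inferInstance, hbot⟩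
  have hmin : ∀ L : Subgroup G, L.Normal → L ≠ ⊥ → L ≤ M → L = M :=
    fun L h1 h2 h3 => le_antisymm h3 (hMmin ⟨h1, h2⟩ h3)
  have hM : M.PreservesGeneratingPairs := fun n hn => hN n (hMN hn)
  have hMcomm := hM.isMulCommutative_of_minimal hmate hMbot hmin
  obtain ⟨x, hxM, hx1⟩ := (bot_or_exists_ne_one M).resolve_left hMbot
  obtain ⟨y, hy⟩ := hmate x hx1
  have hcomm_of : x * y = y * x → a * b = b * a := by
    intro hxy
    have hcomm : ∀ u ∈ ({x, y} : Set G), ∀ v ∈ ({x, y} : Set G), u * v = v * u := by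
      rintro u (rfl | rfl) v (rfl | rfl)
      exacts [rfl, hxy, hxy.symm, rfl]
    have := isMulCommutative_closure hcomm
    have ha : a ∈ closure {x, y} := hy ▸ mem_top a
    have hb : b ∈ closure {x, y} := hy ▸ mem_top b
    exact congrArg Subtype.val (mul_comm' (⟨a, ha⟩ : closure ({x, y} : Set G)) ⟨b, hb⟩)
  by_cases hxy : x * y = y * x
  · exact hcomm_of hxy
  -- `H ⊓ M` is normalized by `y ∈ H` and centralized by `x`, as `M` is abelian; it contains the
  -- commutator of `x` and `y`, so by minimality it is `M`.
  set H := closure {x * y * x⁻¹, y} with hH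
  have hyH : y ∈ H := right_mem_closure_pair _ _
  have hcH : x * y * x⁻¹ * y⁻¹ ∈ H := mul_mem (left_mem_closure_pair _ _) (inv_mem hyH)
  have hcM : x * y * x⁻¹ * y⁻¹ ∈ M := by
    simpa [mul_assoc] using mul_mem hxM (hMnormal.conj_mem _ (inv_mem hxM) y)
  have hnorm : (H ⊓ M).Normal := by
    rw [← normalizer_eq_top_iff, eq_top_iff, ← hy, closure_le]
    have key : ∀ z ∈ ({x, y} : Set G), ∀ h, h ∈ H ⊓ M ↔ z * h * z⁻¹ ∈ H ⊓ M := by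
      rintro z (rfl | rfl) h
      · by_cases hh : h ∈ M
        · rw [hMcomm _ hxM _ hh, mul_inv_cancel_right]
        · have : z * h * z⁻¹ ∉ M := fun hc =>
            hh (by simpa [mul_assoc] using hMnormal.conj_mem _ hc z⁻¹)
          simp [mem_inf, hh, this]
      · rw [mem_inf, mem_inf, mul_mem_cancel_right (inv_mem hyH), mul_mem_cancel_left hyH]
        refine and_congr_right fun _ => ⟨fun hh => hMnormal.conj_mem _ hh _, fun hc => ?_⟩
        simpa [mul_assoc] using hMnormal.conj_mem _ hc z⁻¹
    exact fun z hz => mem_normalizer_iff.2 (key z hz)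
  have hle : H ⊓ M = M := by
    refine hmin _ hnorm (fun h => hxy ?_) inf_le_right
    have : x * y * x⁻¹ * y⁻¹ ∈ (⊥ : Subgroup G) := h ▸ mem_inf.2 ⟨hcH, hcM⟩
    rw [mem_bot, mul_inv_eq_one, mul_inv_eq_iff_eq_mul] at this
    exact this
  have hHtop : H = ⊤ :=
    closure_pair_eq_top_of_mem hy (inf_eq_right.1 hle hxM) hyH
  -- Undoing the conjugation by `x` shows that `y` alone generates `G`, so `x` is a power of `y`.
  have hyy := (hM x hxM y y).1 hHtop
  rw [Set.pair_eq_singleton, ← zpowers_eq_closure] at hyy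
  obtain ⟨i, hi⟩ := hyy ▸ mem_top x
  refine absurd ?_ hxy
  rw [← hi]
  exact ((Commute.refl y).zpow_left i)

/-- The commutator of conjugation by `g⁻¹` with `a` is conjugation by `g⁻¹ * a g`, and it lies in
the normal subgroup `K`. -/
theorem inv_mul_apply_mem_comap_conj (K : Subgroup (MulAut G)) (hK : K.Normal) {a : MulAut G}
    (ha : a ∈ K) (g : G) : g⁻¹ * a g ∈ K.comap MulAut.conj := by
  have h : MulAut.conj g⁻¹ * a * (MulAut.conj g⁻¹)⁻¹ * a⁻¹ = MulAut.conj (g⁻¹ * a g) := by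
    ext x
    simp [mul_assoc]
  rw [mem_comap, ← h]
  exact mul_mem (hK.conj_mem a ha _) (inv_mem ha)

end Subgroup

theorem toAutStar_injective_of_not_comm {G : Type*} [Group G] [Finite G]
    (hspread : spread G ≠ 0) (hG : ¬ ∀ x y : G, x * y = y * x) :
    Function.Injective (toAutStar G) := by
  let N : Subgroup G := (toAutStar G).ker.comap MulAut.conj
  have hN : N.PreservesGeneratingPairs := by
    intro n hn x y
    have h := (mem_ker_toAutStar_iff (MulAut.conj n)).1 (Subgroup.mem_comap.1 hn) x y
    rwa [MulAut.conj_apply] at h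
  have hNbot : N = ⊥ := by
    by_contra hne
    exact hG (hN.mul_comm_of_ne_bot
      (fun s hs => exists_closure_pair_eq_top_of_spread_ne_zero hspread hs) hne)
  rw [← MonoidHom.ker_eq_bot_iff, Subgroup.eq_bot_iff_forall]
  intro a ha
  ext g
  have hmem : g⁻¹ * a g ∈ N :=
    Subgroup.inv_mul_apply_mem_comap_conj _ (MonoidHom.normal_ker (toAutStar G)) ha g
  rw [hNbot, Subgroup.mem_bot, inv_mul_eq_one] at hmem
  exact hmem.symm

theorem isKleinFour_of_sq_eq_one {G : Type*} [Group G] [Finite G] (hcard : 2 < Nat.card G)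
    (hmate : ∀ s : G, s ≠ 1 → ∃ x : G, Subgroup.closure {s, x} = ⊤)
    (hcomm : ∀ x y : G, x * y = y * x) (hsq : ∀ x : G, x ^ 2 = 1) : IsKleinFour G := by
  let _ : CommGroup G := { ‹Group G› with mul_comm := hcomm }
  have : Nontrivial G := Finite.one_lt_card_iff_nontrivial.1 (by omega)
  obtain ⟨x, hx⟩ := exists_ne (1 : G)
  obtain ⟨y, hy⟩ := hmate x hx
  have hord : orderOf x = 2 := orderOf_eq_prime (hsq x) hx
  have hzpow : ∀ (z : G) (i : ℤ), ∃ e : Fin 2, z ^ (e : ℕ) = z ^ i := by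
    intro z i
    rcases Int.even_or_odd' i with ⟨k, rfl | rfl⟩
    · exact ⟨0, by rw [zpow_mul]; simp [zpow_ofNat, hsq]⟩
    · exact ⟨1, by rw [zpow_add, zpow_mul]; simp [zpow_ofNat, hsq]⟩
  have hle : Nat.card G ≤ 4 := by
    have hsurj : Function.Surjective
        (fun e : Fin 2 × Fin 2 => x ^ (e.1 : ℕ) * y ^ (e.2 : ℕ)) := by
      intro z
      obtain ⟨i, j, rfl⟩ := Subgroup.mem_closure_pair.1 (hy ▸ Subgroup.mem_top z)
      obtain ⟨e, he⟩ := hzpow x i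
      obtain ⟨f, hf⟩ := hzpow y j
      exact ⟨(e, f), by simp only [he, hf]⟩
    simpa using Nat.card_le_card_of_surjective _ hsurj
  have hdvd : 2 ∣ Nat.card G := hord ▸ orderOf_dvd_natCard x
  -- The order is even, exceeds 2 and is at most 4.
  refine ⟨by omega, Nat.dvd_antisymm (Monoid.exponent_dvd_of_forall_pow_eq_one hsq) ?_⟩
  exact hord ▸ Monoid.order_dvd_exponent x

theorem mainTheorem10 {G : Type*} [Group G] [Finite G] (hspread : spread G ≠ 0)
    (hcard : 2 < Nat.card G) (hklein : ¬ IsKleinFour G) :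
    Function.Bijective (toAutStar G) ↔ ¬ ∀ x y : G, x * y = y * x := by
  constructor
  · intro hbij hcomm
    refine hklein (isKleinFour_of_sq_eq_one hcard
      (fun s hs => exists_closure_pair_eq_top_of_spread_ne_zero hspread hs) hcomm fun x => ?_)
    let inversion : MulAut G :=
      { toEquiv := Equiv.inv G
        map_mul' := fun x y => by simp [hcomm x⁻¹] }
    have hker : inversion ∈ (toAutStar G).ker := by
      rw [mem_ker_toAutStar_iff]
      intro x y
      constructor
      · intro h
        exact Subgroup.closure_pair_eq_top_of_mem h
          (inv_mem (Subgroup.left_mem_closure_pair x y)) (Subgroup.right_mem_closure_pair x y)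
      · intro h
        refine Subgroup.closure_pair_eq_top_of_mem h ?_ (Subgroup.right_mem_closure_pair _ y)
        simpa [inversion] using inv_mem (Subgroup.left_mem_closure_pair (inversion x) y)
    rw [(MonoidHom.ker_eq_bot_iff _).2 hbij.injective, Subgroup.mem_bot] at hker
    have hinv : x⁻¹ = x := DFunLike.congr_fun hker x
    rw [pow_two, ← inv_eq_iff_mul_eq_one, hinv]
  · intro hG
    exact ⟨toAutStar_injective_of_not_comm hspread hG, MonoidHom.rangeRestrict_surjective _⟩
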